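/- Let $r\ge 2$ and let $S^r(\mathbb C^2)$ be the irreducible representation of $\mathfrak{sl}_2(\mathbb C)$ of dimension $r+1$, with basis $x_i=Y^ix_0/i!$, $0\le i\le r$, where $x_0$ is a vector of maximal weight and $Y=\begin{pmatrix}0&0\\1&0\end{pmatrix}$; use these coordinates on $\mathbb P^r=\mathbb P S^r(\mathbb C^2)$. For an integer $m$ with $0\le 2m\le r$ let $f_m\colon S^2(S^r(\mathbb C^2))\to S^{2r-4m}(\mathbb C^2)$ be the projection, that is, a nonzero $\mathfrak{sl}_2(\mathbb C)$-equivariant linear map (such a map exists; the statements below hold for every choice of it), and let $$M_m=\{x\in\mathbb P S^r(\mathbb C^2)\;:\;f_m(xx)=0\}.$$ For $p\ge 0$ let the $p$-osculating variety $T^pc_r\subseteq\mathbb P^r$ of the rational normal curve $c_r(t)=(1,t,t^2,\dots,t^r)$ be the Zariski closure of the set of points $$c_r(t)+\lambda_1c_r'(t)+\dots+\lambda_pc_r^{(p)}(t),\qquad t,\lambda_1,\dots,\lambda_p\in\mathbb C,$$ so that $T^0c_r=c_r$. Then: 1. if $m\ge 1$, then $T^{m-1}c_r\subseteq M_m$;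 2. $T^{m}c_r\not\subseteq M_m$; 3. if $m\ge 1$, then $\dim M_m\ge m$ (dimension in the Zariski topology). -/

import Mathlib

open scoped TensorProduct LinearAlgebra.Projectivization

noncomputable section

namespace OsculatingVeronese

attribute [local instance] LieRing.ofAssociativeRing

/-- The Lie algebra of traceless complex two by two matrices. -/
abbrev SL2 : Type := LieAlgebra.SpecialLinear.sl (Fin 2) ℂ

/-- The symmetric power `S^r(ℂ²)`, realised as the space of homogeneous polynomials of degree `r`
in the standard basis vectors `e₀ = X 0`, `e₁ = X 1` of `ℂ²`. -/
abbrev BinForm (r : ℕ) : Type := MvPolynomial.homogeneousSubmodule (Fin 2) ℂ r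

/-- The derivation of `Sym(ℂ²) = ℂ[e₀, e₁]` which extends the endomorphism `e_j ↦ A e_j` of `ℂ²`. -/
def matDerivation (A : Matrix (Fin 2) (Fin 2) ℂ) :
    Derivation ℂ (MvPolynomial (Fin 2) ℂ) (MvPolynomial (Fin 2) ℂ) :=
  MvPolynomial.mkDerivation ℂ (fun j => ∑ i, MvPolynomial.C (A i j) * MvPolynomial.X i)

lemma matDerivation_X (A : Matrix (Fin 2) (Fin 2) ℂ) (j : Fin 2) :
    matDerivation A (MvPolynomial.X j) = ∑ i, MvPolynomial.C (A i j) * MvPolynomial.X i := by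
  simp [matDerivation]

lemma matDerivation_add (A B : Matrix (Fin 2) (Fin 2) ℂ) :
    matDerivation (A + B) = matDerivation A + matDerivation B := by
  apply MvPolynomial.derivation_ext
  intro j
  simp [matDerivation_X]
  ring

lemma matDerivation_smul (c : ℂ) (A : Matrix (Fin 2) (Fin 2) ℂ) :
    matDerivation (c • A) = c • matDerivation A := by
  apply MvPolynomial.derivation_ext
  intro j
  simp [matDerivation_X, MvPolynomial.smul_eq_C_mul]
  ring

lemma matDerivation_lie (A B : Matrix (Fin 2) (Fin 2) ℂ) :
    matDerivation ⁅A, B⁆ = ⁅matDerivation A, matDerivation B⁆ := by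
  apply MvPolynomial.derivation_ext
  intro j
  simp only [Derivation.commutator_apply, matDerivation_X, Fin.sum_univ_two, map_add,
    Derivation.leibniz, MvPolynomial.derivation_C, smul_eq_mul, mul_zero, add_zero,
    Ring.lie_def, Matrix.sub_apply, Matrix.mul_apply, map_sub, map_mul]
  ring

lemma matDerivation_mem {r : ℕ} (A : Matrix (Fin 2) (Fin 2) ℂ) {p : MvPolynomial (Fin 2) ℂ}
    (hp : p ∈ MvPolynomial.homogeneousSubmodule (Fin 2) ℂ r) :
    matDerivation A p ∈ MvPolynomial.homogeneousSubmodule (Fin 2) ℂ r := by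
  rw [MvPolynomial.mem_homogeneousSubmodule] at hp ⊢
  have key : matDerivation A = ∑ j, (matDerivation A (MvPolynomial.X j)) •
      MvPolynomial.pderiv (R := ℂ) j := by
    apply MvPolynomial.derivation_ext
    intro k
    fin_cases k <;> simp [Fin.sum_univ_two]
  have hX : ∀ j, (matDerivation A (MvPolynomial.X j)).IsHomogeneous 1 := by
    intro j
    rw [matDerivation_X]
    exact MvPolynomial.IsHomogeneous.sum _ _ _ (fun i _ => MvPolynomial.isHomogeneous_C_mul_X _ i)
  rcases Nat.eq_zero_or_pos r with rfl | h
  · rw [← MvPolynomial.totalDegree_zero_iff_isHomogeneous] at hp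
    rw [MvPolynomial.totalDegree_eq_zero_iff_eq_C.mp hp, MvPolynomial.derivation_C]
    exact MvPolynomial.isHomogeneous_zero _ _ _
  · rw [key, Fin.sum_univ_two, Derivation.add_apply, Derivation.smul_apply, Derivation.smul_apply,
      smul_eq_mul, smul_eq_mul]
    have h1 : 1 + (r - 1) = r := by omega
    exact (h1 ▸ (hX 0).mul hp.pderiv).add (h1 ▸ (hX 1).mul hp.pderiv)

/-- The representation of `sl₂(ℂ)` on `S^r(ℂ²)` induced by the standard one on `ℂ²`. -/
def slRep (r : ℕ) : SL2 →ₗ⁅ℂ⁆ Module.End ℂ (BinForm r) where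
  toFun A := ((matDerivation A.1).toLinearMap).restrict (fun _ hp => matDerivation_mem A.1 hp)
  map_add' A B := by
    ext1 p
    apply Subtype.ext
    simp [LinearMap.restrict_apply, matDerivation_add]
  map_smul' c A := by
    ext1 p
    apply Subtype.ext
    simp [LinearMap.restrict_apply, matDerivation_smul]
  map_lie' := by
    intro A B
    ext1 p
    apply Subtype.ext
    have h := congrArg (fun D => D (p : MvPolynomial (Fin 2) ℂ)) (matDerivation_lie A.1 B.1)
    simpa [LinearMap.restrict_apply, Derivation.commutator_apply, Ring.lie_def] using h

/-- The product `u v` of two vectors, as an element of the symmetric square `S²(V)`. -/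
def symMul {V : Type} [AddCommGroup V] [Module ℂ V] (u v : V) : Sym[ℂ]^2 V :=
  SymmetricPower.tprod ℂ ![u, v]

/-- A linear map `S²(S^r(ℂ²)) → S^n(ℂ²)` is `sl₂(ℂ)`-equivariant. As `sl₂(ℂ)` acts on the symmetric
square by `A (u v) = (A u) v + u (A v)` and the products `u v` span it, it is enough to say this on
products. -/
def IsEquivariant {r n : ℕ} (f : Sym[ℂ]^2 (BinForm r) →ₗ[ℂ] BinForm n) : Prop :=
  ∀ (A : SL2) (u v : BinForm r),
    f (symMul (slRep r A u) v + symMul u (slRep r A v)) = slRep n A (f (symMul u v))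

/-- The locus `{x ∈ ℙ S^r(ℂ²) | f(x x) = 0}`; the condition does not depend on the
representative. -/
def quadricLocus {r n : ℕ} (f : Sym[ℂ]^2 (BinForm r) →ₗ[ℂ] BinForm n) : Set (ℙ ℂ (BinForm r)) :=
  {x | f (symMul x.rep x.rep) = 0}

/-- The projective zero set in `ℙ(V)` of a (homogeneous) polynomial in the linear forms on `V`. -/
def zeroSet {V : Type} [AddCommGroup V] [Module ℂ V] (F : MvPolynomial (Module.Dual ℂ V) ℂ) :
    Set (ℙ ℂ V) :=
  {x | MvPolynomial.eval (fun φ : Module.Dual ℂ V => φ x.rep) F = 0}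

/-- The Zariski topology on `ℙ(V)`: the complements of the zero sets of single homogeneous
polynomials are a basis of it. -/
instance zariskiTopology {V : Type} [AddCommGroup V] [Module ℂ V] : TopologicalSpace (ℙ ℂ V) :=
  TopologicalSpace.generateFrom
    {U | ∃ (d : ℕ) (F : MvPolynomial (Module.Dual ℂ V) ℂ), F.IsHomogeneous d ∧ U = (zeroSet F)ᶜ}

/-- The element `Y` of the standard basis `X, H, Y` of `sl₂(ℂ)`. -/
def slY : SL2 := ⟨!![0, 0; 1, 0], by
  change _ ∈ LinearMap.ker (Matrix.traceLinearMap (Fin 2) ℂ ℂ)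
  simp [Matrix.trace_fin_two]⟩

/-- The vector `x₀ = e₀ ^ r` of maximal weight. -/
def maxVec (r : ℕ) : BinForm r :=
  ⟨MvPolynomial.X 0 ^ r, by
    simpa using (MvPolynomial.isHomogeneous_X ℂ (0 : Fin 2)).pow r⟩

/-- The basis vectors `x_i = Y^i x₀ / i!` of `S^r(ℂ²)`, for `0 ≤ i ≤ r`. -/
def wtVec (r : ℕ) (i : Fin (r + 1)) : BinForm r :=
  ((i : ℕ).factorial : ℂ)⁻¹ • ((slRep r slY) ^ (i : ℕ)) (maxVec r)

/-- The vector with coordinates `(d/dt)^k (1, t, …, t^r)` in the basis `x₀, …, x_r`, that is, the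
`k`-th derivative of the parametrised rational normal curve. -/
def curveDeriv (r k : ℕ) (t : ℂ) : BinForm r :=
  ∑ i : Fin (r + 1), (iteratedDeriv k (fun s : ℂ => s ^ (i : ℕ)) t) • wtVec r i

/-- The vector `c_r(t) + l₁ c_r'(t) + … + l_p c_r^(p)(t)`. -/
def osculatingVec (r p : ℕ) (t : ℂ) (l : Fin p → ℂ) : BinForm r :=
  curveDeriv r 0 t + ∑ j : Fin p, l j • curveDeriv r ((j : ℕ) + 1) t

/-- The `p`-osculating variety `T^p c_r` of the rational normal curve in `ℙ S^r(ℂ²)`: the Zariski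
closure of its parametrised part. (The vectors `osculatingVec r p t l` are never zero, their
coordinate at `x₀` being `1`.) For `p = 0` it is the rational normal curve itself. -/
def osculatingVariety (r p : ℕ) : Set (ℙ ℂ (BinForm r)) :=
  closure {x | ∃ (t : ℂ) (l : Fin p → ℂ) (h : osculatingVec r p t l ≠ 0),
    x = Projectivization.mk ℂ (osculatingVec r p t l) h}

end OsculatingVeronese

end

open OsculatingVeronese

/-!
A linear map `f` on the symmetric square is the symmetric bilinear map `B(u, v) = f(u v)`, and the
argument is a computation with weights of `B` on the vectors `Y^k x₀`.

The `k`-th derivative of the rational normal curve at `t` is `exp(tY) Y^k x₀`, hence a vector of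
weight `r - 2k` for the conjugate `exp(tY) H exp(-tY) = H + 2tY` of `H` (`slRep_slH_curveDeriv`).
For `i + j < 2m` the product of the `i`-th and the `j`-th derivative therefore has weight
`2r - 2(i + j) > 2r - 4m`, which is larger than any weight of `S^{2r-4m}(ℂ²)`
(`eq_zero_of_slH_eigenvalue_gt`), and `B` vanishes on it. This gives the inclusion of `T^{m-1}c_r`.

On the vectors `Y^i x₀`, `Y^j x₀` with `i + j = 2m` the values of `B` alternate in sign, because
`Y` applied to the zero value `B(Y^i x₀, Y^{j-1} x₀)` is a sum of two such values. If
`B(Y^m x₀, Y^m x₀)` were zero, all of them would be zero; for `i + j > 2m` the values would then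
vanish successively, being annihilated by `X` and of weight different from the highest one, so that
`f = 0` (`IsEquivariant.bilin_lowVec_middle_ne_zero`).
The square of `x₀ + Y^m x₀` (of `x₀` if `m = 0`) has the same image as that of `Y^m x₀`, and this
vector lies on the `m`-th osculating space at `t = 0`. So `T^m c_r` is not contained in the quadratic
locus.

A nonzero equivariant map exists: the transvectant of order `2m`, the Cayley operator
`Ω = ∂₀ ⊗ ∂₁ - ∂₁ ⊗ ∂₀` iterated `2m` times and followed by multiplication. It is equivariant as `Ω`
commutes with traceless matrices (`cayleyOmega_mul_tensorDerivation`).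

For the dimension, the varieties `T^p c_r` are irreducible, as closures of sets parametrised
polynomially by affine spaces. The inclusion and the non-inclusion above, applied to `p + 1` in
place of `m`, show that `T^p c_r ≠ T^{p+1} c_r` when `2(p + 1) ≤ r`. So
`closure {x₀} ⊂ T^0 c_r ⊂ … ⊂ T^{m-1} c_r` is a chain of length `m` in the quadratic locus.
-/

noncomputable section

namespace OsculatingVeronese

section Polynomials

open MvPolynomial

/-! ### Derivations in coordinates -/

lemma matDerivation_apply (A : Matrix (Fin 2) (Fin 2) ℂ) (p : MvPolynomial (Fin 2) ℂ) :
    matDerivation A p = (C (A 0 0) * X 0 + C (A 1 0) * X 1) * pderiv 0 p +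
      (C (A 0 1) * X 0 + C (A 1 1) * X 1) * pderiv 1 p := by
  have key : matDerivation A = (C (A 0 0) * X 0 + C (A 1 0) * X 1 : MvPolynomial (Fin 2) ℂ) •
      pderiv (R := ℂ) 0 + (C (A 0 1) * X 0 + C (A 1 1) * X 1 : MvPolynomial (Fin 2) ℂ) •
      pderiv (R := ℂ) 1 := by
    apply MvPolynomial.derivation_ext
    intro k
    fin_cases k <;> simp [matDerivation_X, Fin.sum_univ_two]
  rw [key]
  simp

/-- The element `exp(tY) H exp(-tY) = H + 2tY` of `sl₂(ℂ)`. -/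
def slH (t : ℂ) : SL2 := ⟨!![1, 0; 2 * t, -1], by
  change _ ∈ LinearMap.ker (Matrix.traceLinearMap (Fin 2) ℂ ℂ)
  simp [Matrix.trace_fin_two]⟩

/-- The element `X` of the standard basis `X, H, Y` of `sl₂(ℂ)`. -/
def slX : SL2 := ⟨!![0, 1; 0, 0], by
  change _ ∈ LinearMap.ker (Matrix.traceLinearMap (Fin 2) ℂ ℂ)
  simp [Matrix.trace_fin_two]⟩

lemma coe_slRep {r : ℕ} (A : SL2) (u : BinForm r) :
    (slRep r A u : MvPolynomial (Fin 2) ℂ) = matDerivation A.1 u := rfl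

lemma coe_slRep_slY {r : ℕ} (u : BinForm r) :
    (slRep r slY u : MvPolynomial (Fin 2) ℂ) = X 1 * pderiv 0 (u : MvPolynomial (Fin 2) ℂ) := by
  rw [coe_slRep, matDerivation_apply]
  simp [slY]

lemma coe_slRep_slX {r : ℕ} (u : BinForm r) :
    (slRep r slX u : MvPolynomial (Fin 2) ℂ) = X 0 * pderiv 1 (u : MvPolynomial (Fin 2) ℂ) := by
  rw [coe_slRep, matDerivation_apply]
  simp [slX]

lemma coe_slRep_slH {r : ℕ} (t : ℂ) (u : BinForm r) :
    (slRep r (slH t) u : MvPolynomial (Fin 2) ℂ) =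
      (X 0 + C (2 * t) * X 1) * pderiv 0 (u : MvPolynomial (Fin 2) ℂ)
        - X 1 * pderiv 1 (u : MvPolynomial (Fin 2) ℂ) := by
  rw [coe_slRep, matDerivation_apply]
  simp [slH]
  ring

lemma slRep_slH {r : ℕ} (t : ℂ) (u : BinForm r) :
    slRep r (slH t) u = slRep r (slH 0) u + (2 * t) • slRep r slY u := by
  apply Subtype.ext
  rw [Submodule.coe_add, Submodule.coe_smul, coe_slRep_slH, coe_slRep_slH, coe_slRep_slY,
    MvPolynomial.smul_eq_C_mul]
  simp
  ring

lemma X_mul_pderiv_add_X_mul_pderiv {n : ℕ} (u : BinForm n) :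
    (X 0 * pderiv 0 (u : MvPolynomial (Fin 2) ℂ) + X 1 * pderiv 1 (u : MvPolynomial (Fin 2) ℂ)) =
      C (n : ℂ) * (u : MvPolynomial (Fin 2) ℂ) := by
  have h := ((mem_homogeneousSubmodule _ _).1 u.2).sum_X_mul_pderiv
  rw [Fin.sum_univ_two] at h
  rw [h]
  simp

/-- The largest eigenvalue of `exp(tY) H exp(-tY)` on `S^n(ℂ²)` is `n`. -/
lemma eq_zero_of_slH_eigenvalue_gt {n d : ℕ} (hd : 0 < d) (t : ℂ) (u : BinForm n)
    (h : slRep n (slH t) u = ((n : ℂ) + 2 * d) • u) : u = 0 := by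
  -- Subtracting Euler's identity turns the eigenvector equation into a divisibility by `X 1`.
  have h1 : C (d : ℂ) * (u : MvPolynomial (Fin 2) ℂ) =
      X 1 * (C t * pderiv 0 (u : MvPolynomial (Fin 2) ℂ) -
        pderiv 1 (u : MvPolynomial (Fin 2) ℂ)) := by
    have h2 := congrArg (Subtype.val) h
    rw [coe_slRep_slH, Submodule.coe_smul, MvPolynomial.smul_eq_C_mul] at h2
    have h3 := X_mul_pderiv_add_X_mul_pderiv u
    simp only [map_add, map_mul] at h2
    have h4 : (C (2 : ℂ) : MvPolynomial (Fin 2) ℂ) = 2 := map_ofNat C 2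
    rw [h4] at h2
    have h5 : (2 : MvPolynomial (Fin 2) ℂ) ≠ 0 := two_ne_zero
    apply mul_left_cancel₀ h5
    linear_combination h3 - h2
  -- Hence the coefficients vanish, by induction on the exponent of `X 1`.
  have key : ∀ (b : ℕ) (s : Fin 2 →₀ ℕ), s 1 = b → coeff s (u : MvPolynomial (Fin 2) ℂ) = 0 := by
    intro b
    induction b with
    | zero =>
      intro s hs
      have h2 := congrArg (coeff s) h1
      rw [coeff_C_mul, coeff_X_mul', if_neg (by simp [hs])] at h2
      simpa [hd.ne'] using h2
    | succ b ih =>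
      intro s hs
      obtain ⟨s', rfl⟩ : ∃ s', s = Finsupp.single 1 1 + s' := by
        refine ⟨s - Finsupp.single 1 1, (add_tsub_cancel_of_le ?_).symm⟩
        simp [hs]
      have h2 := congrArg (coeff (Finsupp.single 1 1 + s')) h1
      have hs' : s' 1 = b := by simpa [add_comm 1] using hs
      rw [coeff_C_mul, coeff_X_mul, coeff_sub, coeff_C_mul, coeff_pderiv, coeff_pderiv,
        ih (s' + Finsupp.single 0 1) (by simp [hs']), add_comm s' (Finsupp.single 1 1)] at h2
      have h6 : ((d : ℂ) + (b + 1)) * coeff (Finsupp.single 1 1 + s') (u : MvPolynomial (Fin 2) ℂ)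
          = 0 := by
        rw [hs'] at h2
        linear_combination h2
      rcases mul_eq_zero.1 h6 with h7 | h7
      · have : ((d + (b + 1) : ℕ) : ℂ) = 0 := by push_cast; exact h7
        exact absurd (Nat.cast_eq_zero.1 this) (by omega)
      · exact h7
  apply Subtype.ext
  ext s
  simpa using key _ s rfl

/-- The only weight of a vector of `S^n(ℂ²)` annihilated by `X` is `n`. -/
lemma eq_zero_of_slX_eq_zero {n : ℕ} {c : ℂ} (hc : c ≠ n) (u : BinForm n)
    (hX : slRep n slX u = 0) (hH : slRep n (slH 0) u = c • u) : u = 0 := by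
  have h1 := congrArg Subtype.val hX
  have h2 := congrArg Subtype.val hH
  rw [coe_slRep_slX] at h1
  rw [coe_slRep_slH, Submodule.coe_smul, MvPolynomial.smul_eq_C_mul] at h2
  have h3 := X_mul_pderiv_add_X_mul_pderiv u
  have h4 : pderiv 1 (u : MvPolynomial (Fin 2) ℂ) = 0 := by simpa using h1
  have h5 : C (c - n) * (u : MvPolynomial (Fin 2) ℂ) = 0 := by
    simp only [h4, mul_zero, map_zero, zero_mul, add_zero, sub_zero] at h2 h3
    rw [map_sub]
    linear_combination h3 - h2
  rcases mul_eq_zero.1 h5 with h6 | h6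
  · rw [map_eq_zero_iff _ (C_injective _ _)] at h6
    exact absurd (sub_eq_zero.1 h6) hc
  · exact Subtype.ext h6

/-! ### The weight vectors and the derivatives of the curve -/

/-- The vector `Y^k x₀ = k! x_k` of `S^r(ℂ²)`, which is `0` for `k > r`. -/
def lowVec (r k : ℕ) : BinForm r := ((slRep r slY) ^ k) (maxVec r)

lemma slRep_slY_lowVec (r k : ℕ) : slRep r slY (lowVec r k) = lowVec r (k + 1) := by
  rw [lowVec, lowVec, pow_succ']
  rfl

lemma coe_lowVec (r k : ℕ) : (lowVec r k : MvPolynomial (Fin 2) ℂ) =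
    C (r.descFactorial k : ℂ) * (X 0 ^ (r - k) * X 1 ^ k) := by
  induction k with
  | zero => simp [lowVec, maxVec]
  | succ k ih =>
    rw [← slRep_slY_lowVec, coe_slRep_slY, ih]
    simp [Nat.descFactorial_succ, Nat.sub_sub]
    ring

lemma lowVec_eq_zero {r k : ℕ} (h : r < k) : lowVec r k = 0 := by
  apply Subtype.ext
  rw [coe_lowVec, Nat.descFactorial_of_lt h]
  simp

lemma slRep_slH_lowVec (r k : ℕ) :
    slRep r (slH 0) (lowVec r k) = ((r : ℂ) - 2 * k) • lowVec r k := by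
  rcases lt_or_ge r k with h | h
  · simp [lowVec_eq_zero h]
  apply Subtype.ext
  have h3 := X_mul_pderiv_add_X_mul_pderiv (lowVec r k)
  have h4 : X 1 * pderiv 1 (lowVec r k : MvPolynomial (Fin 2) ℂ) =
      C (k : ℂ) * (lowVec r k : MvPolynomial (Fin 2) ℂ) := by
    rw [coe_lowVec]
    rcases k with _ | k
    · simp
    · simp
      ring
  rw [coe_slRep_slH, Submodule.coe_smul, MvPolynomial.smul_eq_C_mul]
  have h6 : (C (2 : ℂ) : MvPolynomial (Fin 2) ℂ) = 2 := map_ofNat C 2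
  simp only [mul_zero, map_zero, zero_mul, add_zero, map_sub, map_mul, h6]
  linear_combination h3 - 2 * h4

lemma slRep_slX_lowVec_zero (r : ℕ) : slRep r slX (lowVec r 0) = 0 := by
  apply Subtype.ext
  rw [coe_slRep_slX, coe_lowVec]
  simp

lemma exists_slRep_slX_lowVec_succ (r k : ℕ) :
    ∃ c : ℂ, slRep r slX (lowVec r (k + 1)) = c • lowVec r k := by
  rcases lt_or_ge r (k + 1) with h | h
  · exact ⟨0, by simp [lowVec_eq_zero h]⟩
  refine ⟨((r - k : ℕ) : ℂ) * (k + 1), ?_⟩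
  apply Subtype.ext
  obtain ⟨a, rfl⟩ := Nat.exists_eq_add_of_le h
  rw [coe_slRep_slX, Submodule.coe_smul, MvPolynomial.smul_eq_C_mul, coe_lowVec, coe_lowVec,
    Nat.descFactorial_succ, show k + 1 + a - (k + 1) = a by omega,
    show k + 1 + a - k = a + 1 by omega]
  simp
  ring

lemma span_lowVec (r : ℕ) : Submodule.span ℂ (Set.range (lowVec r)) = ⊤ := by
  rw [eq_top_iff]
  rintro ⟨p, hp⟩ -
  have key : p ∈ (Submodule.span ℂ (Set.range (lowVec r))).map (Submodule.subtype _) := by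
    rw [p.as_sum]
    refine Submodule.sum_mem _ fun s hs => ?_
    have hs' : s 0 + s 1 = r := by
      have := ((mem_homogeneousSubmodule _ _).1 hp) (mem_support_iff.1 hs)
      rw [Finsupp.weight_apply, Finsupp.sum_fintype _ _ (by simp)] at this
      simpa [Fin.sum_univ_two] using this
    have hd : (r.descFactorial (s 1) : ℂ) ≠ 0 := by
      rw [Nat.cast_ne_zero, Ne, Nat.descFactorial_eq_zero_iff_lt]
      omega
    refine ⟨(coeff s p / r.descFactorial (s 1)) • lowVec r (s 1),
      Submodule.smul_mem _ _ (Submodule.subset_span ⟨_, rfl⟩), ?_⟩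
    rw [Submodule.subtype_apply, Submodule.coe_smul, MvPolynomial.smul_eq_C_mul, coe_lowVec,
      ← mul_assoc, ← C_mul, div_mul_cancel₀ _ hd, monomial_eq, Finsupp.prod_fintype _ _ (by simp),
      Fin.prod_univ_two, ← hs', Nat.add_sub_cancel]
  obtain ⟨u, hu, rfl⟩ := key
  exact hu

lemma wtVec_eq (r : ℕ) (i : Fin (r + 1)) :
    wtVec r i = ((i : ℕ).factorial : ℂ)⁻¹ • lowVec r i := rfl

lemma curveDeriv_eq_sum_range (r k : ℕ) (t : ℂ) : curveDeriv r k t =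
    ∑ i ∈ Finset.range (r + 1),
      ((i.descFactorial k : ℂ) * t ^ (i - k) * (i.factorial : ℂ)⁻¹) • lowVec r i := by
  rw [curveDeriv, ← Fin.sum_univ_eq_sum_range (fun i =>
    ((i.descFactorial k : ℂ) * t ^ (i - k) * (i.factorial : ℂ)⁻¹) • lowVec r i)]
  refine Finset.sum_congr rfl fun i _ => ?_
  rw [wtVec_eq, smul_smul, iteratedDeriv_pow]

lemma curveDeriv_zero_right {r k : ℕ} (hk : k ≤ r) : curveDeriv r k 0 = lowVec r k := by
  rw [curveDeriv_eq_sum_range, Finset.sum_eq_single k]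
  · simp [Nat.descFactorial_self, Nat.factorial_ne_zero]
  · intro i _ hik
    rcases lt_or_gt_of_ne hik with h | h
    · simp [Nat.descFactorial_of_lt h]
    · simp [Nat.sub_ne_zero_of_lt h]
  · intro h
    exact absurd (Finset.mem_range.2 (by omega)) h

/-- The derivatives of the curve at `t` are weight vectors for the Cartan subalgebra
`exp(tY) ℂH exp(-tY)`, as they are the images of the `Y^k x₀` under `exp(tY)`. -/
lemma slRep_slH_curveDeriv (r k : ℕ) (t : ℂ) :
    slRep r (slH t) (curveDeriv r k t) = ((r : ℂ) - 2 * k) • curveDeriv r k t := by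
  set a : ℕ → ℂ := fun i => (i.descFactorial k : ℂ) * t ^ (i - k) * (i.factorial : ℂ)⁻¹ with ha
  -- The coefficient `a i` is `tⁱ⁻ᵏ / (i - k)!` for `i ≥ k`, and `0` otherwise.
  have hrec : ∀ i : ℕ, t * a i = ((i : ℂ) + 1 - k) * a (i + 1) := by
    intro i
    have hf : ((i + 1).factorial : ℂ)⁻¹ * (i + 1) = (i.factorial : ℂ)⁻¹ := by
      rw [Nat.factorial_succ]
      have h1 : (i.factorial : ℂ) ≠ 0 := by exact_mod_cast i.factorial_ne_zero
      have h2 : (i : ℂ) + 1 ≠ 0 := by exact_mod_cast i.succ_ne_zero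
      push_cast
      field_simp
    simp only [ha]
    rcases lt_trichotomy (i + 1) k with h | h | h
    · rw [Nat.descFactorial_of_lt h, Nat.descFactorial_of_lt (by omega : i < k)]
      simp
    · rw [Nat.descFactorial_of_lt (by omega : i < k), ← h]
      simp
    · obtain ⟨j, rfl⟩ := Nat.exists_eq_add_of_le (show k ≤ i by omega)
      have h3 : ((k + j + 1).descFactorial k : ℂ) * (j + 1) =
          (k + j + 1) * ((k + j).descFactorial k : ℂ) := by
        have := Nat.succ_descFactorial (k + j) k
        rw [show k + j + 1 - k = j + 1 by omega] at this
        rw [mul_comm]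
        exact_mod_cast this
      rw [show k + j + 1 - k = j + 1 by omega, show k + j - k = j by omega, ← hf, pow_succ]
      push_cast
      linear_combination -(t ^ j * t * ((k + j + 1).factorial : ℂ)⁻¹) * h3
  -- The error term of a partial sum is a multiple of `Y^N x₀`, which vanishes for `N = r + 1`.
  have key : ∀ N : ℕ, slRep r (slH t) (∑ i ∈ Finset.range N, a i • lowVec r i) =
      ((r : ℂ) - 2 * k) • (∑ i ∈ Finset.range N, a i • lowVec r i) +
        (2 * (N - k) * a N) • lowVec r N := by
    intro N
    induction N with
    | zero =>
      rcases k with _ | k <;> simp [ha]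
    | succ N ih =>
      rw [Finset.sum_range_succ, map_add, ih, map_smul, slRep_slH, slRep_slH_lowVec,
        slRep_slY_lowVec, smul_add, smul_add, smul_smul, smul_smul, smul_smul,
        show a N * (2 * t) = 2 * (((N + 1 : ℕ) : ℂ) - k) * a (N + 1) by
          push_cast; linear_combination 2 * hrec N]
      module
  rw [curveDeriv_eq_sum_range, key (r + 1), lowVec_eq_zero (Nat.lt_succ_self r), smul_zero,
    add_zero]

end Polynomials

/-! ### The symmetric square -/

lemma update_vecPair_zero {V : Type} (u v x : V) : Function.update ![u, v] 0 x = ![x, v] := by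
  ext i
  fin_cases i <;> rfl

lemma update_vecPair_one {V : Type} (u v x : V) : Function.update ![u, v] 1 x = ![u, x] := by
  ext i
  fin_cases i <;> rfl

/-- The product of two vectors as a bilinear map into the symmetric square. -/
def symMulBilin (V : Type) [AddCommGroup V] [Module ℂ V] : V →ₗ[ℂ] V →ₗ[ℂ] Sym[ℂ]^2 V :=
  LinearMap.mk₂ ℂ symMul
    (fun u u' v => by
      simpa only [update_vecPair_zero, symMul] using
        (SymmetricPower.tprod ℂ (ι := Fin 2) (M := V)).map_update_add ![u, v] 0 u u')
    (fun c u v => by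
      simpa only [update_vecPair_zero, symMul] using
        (SymmetricPower.tprod ℂ (ι := Fin 2) (M := V)).map_update_smul ![u, v] 0 c u)
    (fun u v v' => by
      simpa only [update_vecPair_one, symMul] using
        (SymmetricPower.tprod ℂ (ι := Fin 2) (M := V)).map_update_add ![u, v] 1 v v')
    (fun c u v => by
      simpa only [update_vecPair_one, symMul] using
        (SymmetricPower.tprod ℂ (ι := Fin 2) (M := V)).map_update_smul ![u, v] 1 c v)

section SymmetricSquare

variable {V W : Type} [AddCommGroup V] [Module ℂ V] [AddCommGroup W] [Module ℂ W]

lemma symMul_comm (u v : V) : symMul u v = symMul v u := by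
  have h := SymmetricPower.tprod_equiv (R := ℂ) (Equiv.swap (0 : Fin 2) 1) ![v, u]
  rw [symMul, symMul, ← h]
  congr 1
  ext i
  fin_cases i <;> simp

lemma linearMap_ext_symMul {f g : Sym[ℂ]^2 V →ₗ[ℂ] W}
    (h : ∀ u v, f (symMul u v) = g (symMul u v)) : f = g := by
  refine LinearMap.ext_on_range (SymmetricPower.span_tprod_eq_top ℂ (Fin 2) V) fun w => ?_
  have hw : w = ![w 0, w 1] := by
    ext i
    fin_cases i <;> rfl
  rw [hw]
  exact h _ _

/-- A symmetric bilinear map factors through the symmetric square. -/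
lemma exists_linearMap_symMul (B : V →ₗ[ℂ] V →ₗ[ℂ] W) (hB : ∀ u v, B u v = B v u) :
    ∃ f : Sym[ℂ]^2 V →ₗ[ℂ] W, ∀ u v, f (symMul u v) = B u v := by
  let M : MultilinearMap ℂ (fun _ : Fin 2 => V) W :=
    { toFun := fun w => B (w 0) (w 1)
      map_update_add' := by
        intro _ w i x y
        fin_cases i <;> simp [Function.update]
      map_update_smul' := by
        intro _ w i c x
        fin_cases i <;> simp [Function.update] }
  let L := PiTensorProduct.lift M
  have hL : addConGen (SymmetricPower.Rel ℂ (Fin 2) V) ≤ AddCon.ker L.toAddMonoidHom := by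
    rw [AddCon.addConGen_le]
    rintro x y ⟨e, w⟩
    rw [AddCon.ker_rel]
    simp only [LinearMap.toAddMonoidHom_coe, L, PiTensorProduct.lift.tprod]
    change B (w 0) (w 1) = B (w (e 0)) (w (e 1))
    have h2 : ∀ e : Equiv.Perm (Fin 2), (e 0 = 0 ∧ e 1 = 1) ∨ (e 0 = 1 ∧ e 1 = 0) := by decide
    rcases h2 e with ⟨h0, h1⟩ | ⟨h0, h1⟩
    · rw [h0, h1]
    · rw [h0, h1, hB]
  refine ⟨{ toFun := AddCon.lift _ L.toAddMonoidHom hL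
            map_add' := map_add _
            map_smul' := fun c x => ?_ }, fun u v => ?_⟩
  · induction x using AddCon.induction_on with
    | H x => exact map_smul L c x
  · change L (PiTensorProduct.tprod ℂ ![u, v]) = _
    simp [L, M]

end SymmetricSquare

/-! ### Equivariant maps on products of weight vectors -/

section Equivariant

variable {r n m : ℕ} {f : Sym[ℂ]^2 (BinForm r) →ₗ[ℂ] BinForm n}

/-- The bilinear map `(u, v) ↦ f(u v)`. -/
def bilin (f : Sym[ℂ]^2 (BinForm r) →ₗ[ℂ] BinForm n) :
    BinForm r →ₗ[ℂ] BinForm r →ₗ[ℂ] BinForm n :=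
  (symMulBilin (BinForm r)).compr₂ f

lemma bilin_apply (u v : BinForm r) : bilin f u v = f (symMul u v) := rfl

lemma bilin_comm (u v : BinForm r) : bilin f u v = bilin f v u := by
  rw [bilin_apply, symMul_comm, bilin_apply]

lemma IsEquivariant.slRep_bilin (hf : IsEquivariant f) (A : SL2) (u v : BinForm r) :
    slRep n A (bilin f u v) = bilin f (slRep r A u) v + bilin f u (slRep r A v) := by
  rw [bilin_apply, ← hf A u v, map_add]
  rfl

/-- The weights of two eigenvectors add up. -/
lemma IsEquivariant.slRep_bilin_eigenvector (hf : IsEquivariant f) {A : SL2} {a b : ℂ}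
    {u v : BinForm r} (hu : slRep r A u = a • u) (hv : slRep r A v = b • v) :
    slRep n A (bilin f u v) = (a + b) • bilin f u v := by
  rw [hf.slRep_bilin, hu, hv, map_smul, map_smul, LinearMap.smul_apply, add_smul]

lemma IsEquivariant.bilin_curveDeriv_eq_zero (hf : IsEquivariant f) (hn : n + 4 * m = 2 * r)
    {i j : ℕ} (hij : i + j < 2 * m) (t : ℂ) :
    bilin f (curveDeriv r i t) (curveDeriv r j t) = 0 := by
  refine eq_zero_of_slH_eigenvalue_gt (d := 2 * m - (i + j)) (by omega) t _ ?_
  rw [hf.slRep_bilin_eigenvector (slRep_slH_curveDeriv r i t) (slRep_slH_curveDeriv r j t)]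
  congr 1
  have h : (n : ℂ) + 4 * m = 2 * r := by exact_mod_cast hn
  rw [Nat.cast_sub hij.le]
  push_cast
  linear_combination -h

lemma IsEquivariant.bilin_lowVec_eq_zero (hf : IsEquivariant f) (hn : n + 4 * m = 2 * r)
    {i j : ℕ} (hij : i + j < 2 * m) : bilin f (lowVec r i) (lowVec r j) = 0 := by
  rw [← curveDeriv_zero_right (r := r) (k := i) (by omega),
    ← curveDeriv_zero_right (r := r) (k := j) (by omega)]
  exact hf.bilin_curveDeriv_eq_zero hn hij 0

/-- Applying `Y` to a product of too large a weight shows that the values on the products of weight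
`n` alternate. -/
lemma IsEquivariant.bilin_lowVec_succ (hf : IsEquivariant f) (hn : n + 4 * m = 2 * r)
    {i j : ℕ} (hij : i + j + 1 = 2 * m) :
    bilin f (lowVec r (i + 1)) (lowVec r j) = - bilin f (lowVec r i) (lowVec r (j + 1)) := by
  have h := hf.slRep_bilin slY (lowVec r i) (lowVec r j)
  rw [hf.bilin_lowVec_eq_zero hn (by omega), map_zero, slRep_slY_lowVec, slRep_slY_lowVec] at h
  exact eq_neg_of_add_eq_zero_left h.symm

/-- The case `N = 0` spreads from the middle by alternation; the induction step is an application
of `X`. -/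
lemma IsEquivariant.bilin_lowVec_eq_zero_of_middle (hf : IsEquivariant f)
    (hn : n + 4 * m = 2 * r) (h0 : bilin f (lowVec r m) (lowVec r m) = 0) :
    ∀ N i j : ℕ, i + j = 2 * m + N → bilin f (lowVec r i) (lowVec r j) = 0 := by
  intro N
  induction N with
  | zero =>
    have key : ∀ k ≤ m, bilin f (lowVec r (m + k)) (lowVec r (m - k)) = 0 := by
      intro k
      induction k with
      | zero => intro _; exact h0
      | succ k ih =>
        intro hk
        rw [← add_assoc, hf.bilin_lowVec_succ hn (by omega), show m - (k + 1) + 1 = m - k by omega,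
          ih (by omega), neg_zero]
    intro i j hij
    rcases le_total j i with h | h
    · obtain ⟨k, rfl⟩ := Nat.exists_eq_add_of_le (show m ≤ i by omega)
      rw [show j = m - k by omega]
      exact key k (by omega)
    · obtain ⟨k, rfl⟩ := Nat.exists_eq_add_of_le (show m ≤ j by omega)
      rw [bilin_comm, show i = m - k by omega]
      exact key k (by omega)
  | succ N ih =>
    intro i j hij
    -- The value is annihilated by `X`, but its weight is less than `n`.
    refine eq_zero_of_slX_eq_zero (c := ((r : ℂ) - 2 * i) + ((r : ℂ) - 2 * j)) ?_ _ ?_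
      (hf.slRep_bilin_eigenvector (slRep_slH_lowVec r i) (slRep_slH_lowVec r j))
    · intro h
      have h1 : (n : ℂ) + 4 * m = 2 * r := by exact_mod_cast hn
      have h2 : (i : ℂ) + j = 2 * m + (N + 1) := by exact_mod_cast hij
      have h3 : ((N + 1 : ℕ) : ℂ) = 0 := by
        push_cast
        linear_combination (-1 / 2 : ℂ) * h + (-1 / 2 : ℂ) * h1 - h2
      exact absurd (Nat.cast_eq_zero.1 h3) (by omega)
    · have hl : bilin f (slRep r slX (lowVec r i)) (lowVec r j) = 0 := by
        rcases i with _ | i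
        · rw [slRep_slX_lowVec_zero, map_zero, LinearMap.zero_apply]
        · obtain ⟨c, hc⟩ := exists_slRep_slX_lowVec_succ r i
          rw [hc, map_smul, LinearMap.smul_apply, ih i j (by omega), smul_zero]
      have hr : bilin f (lowVec r i) (slRep r slX (lowVec r j)) = 0 := by
        rcases j with _ | j
        · rw [slRep_slX_lowVec_zero, map_zero]
        · obtain ⟨c, hc⟩ := exists_slRep_slX_lowVec_succ r j
          rw [hc, map_smul, ih i j (by omega), smul_zero]
      rw [hf.slRep_bilin, hl, hr, add_zero]

/-- A nonzero equivariant map does not vanish on the square of the middle weight vector: otherwise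
it would vanish on all products of weight vectors. -/
lemma IsEquivariant.bilin_lowVec_middle_ne_zero (hf : IsEquivariant f) (hn : n + 4 * m = 2 * r)
    (hf0 : f ≠ 0) : bilin f (lowVec r m) (lowVec r m) ≠ 0 := by
  intro h0
  apply hf0
  have hall : ∀ i j : ℕ, bilin f (lowVec r i) (lowVec r j) = 0 := by
    intro i j
    rcases lt_or_ge (i + j) (2 * m) with h | h
    · exact hf.bilin_lowVec_eq_zero hn h
    · exact hf.bilin_lowVec_eq_zero_of_middle hn h0 (i + j - 2 * m) i j (by omega)
  have hB : bilin f = 0 := by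
    refine LinearMap.ext_on_range (span_lowVec r) fun i => ?_
    refine LinearMap.ext_on_range (span_lowVec r) fun j => ?_
    simpa using hall i j
  refine linearMap_ext_symMul fun u v => ?_
  rw [← bilin_apply, hB]
  simp

end Equivariant

section Transvectants

open MvPolynomial

/-! ### Transvectants -/

/-- The Cayley operator `Ω = ∂₀ ⊗ ∂₁ - ∂₁ ⊗ ∂₀`. -/
def cayleyOmega : Module.End ℂ (MvPolynomial (Fin 2) ℂ ⊗[ℂ] MvPolynomial (Fin 2) ℂ) :=
  TensorProduct.map (pderiv 0).toLinearMap (pderiv 1).toLinearMap -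
    TensorProduct.map (pderiv 1).toLinearMap (pderiv 0).toLinearMap

lemma cayleyOmega_tmul (p q : MvPolynomial (Fin 2) ℂ) : cayleyOmega (p ⊗ₜ[ℂ] q) =
    pderiv 0 p ⊗ₜ[ℂ] pderiv 1 q - pderiv 1 p ⊗ₜ[ℂ] pderiv 0 q := rfl

/-- The action of a matrix on `Sym(ℂ²) ⊗ Sym(ℂ²)`. -/
def tensorDerivation (A : Matrix (Fin 2) (Fin 2) ℂ) :
    Module.End ℂ (MvPolynomial (Fin 2) ℂ ⊗[ℂ] MvPolynomial (Fin 2) ℂ) :=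
  TensorProduct.map (matDerivation A).toLinearMap LinearMap.id +
    TensorProduct.map LinearMap.id (matDerivation A).toLinearMap

lemma tensorDerivation_tmul (A : Matrix (Fin 2) (Fin 2) ℂ) (p q : MvPolynomial (Fin 2) ℂ) :
    tensorDerivation A (p ⊗ₜ[ℂ] q) = matDerivation A p ⊗ₜ[ℂ] q + p ⊗ₜ[ℂ] matDerivation A q := rfl

lemma pderiv_matDerivation (A : Matrix (Fin 2) (Fin 2) ℂ) (k : Fin 2)
    (p : MvPolynomial (Fin 2) ℂ) : pderiv k (matDerivation A p) =
      matDerivation A (pderiv k p) + (A k 0 • pderiv 0 p + A k 1 • pderiv 1 p) := by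
  have h : ⁅pderiv (R := ℂ) k, matDerivation A⁆ =
      A k 0 • pderiv (R := ℂ) 0 + A k 1 • pderiv (R := ℂ) 1 := by
    apply MvPolynomial.derivation_ext
    intro j
    rw [Derivation.commutator_apply, matDerivation_X]
    fin_cases k <;> fin_cases j <;>
      simp [Fin.sum_univ_two, MvPolynomial.smul_eq_C_mul]
  have h1 := congrArg (fun D => D p) h
  simp only [Derivation.commutator_apply, Derivation.add_apply, Derivation.smul_apply] at h1
  rw [← h1]
  abel

/-- The Cayley operator commutes with traceless matrices. -/
lemma cayleyOmega_mul_tensorDerivation (A : Matrix (Fin 2) (Fin 2) ℂ) (hA : A 0 0 + A 1 1 = 0) :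
    cayleyOmega * tensorDerivation A = tensorDerivation A * cayleyOmega := by
  refine TensorProduct.ext' fun p q => ?_
  have hA' : A 1 1 = - A 0 0 := eq_neg_of_add_eq_zero_right hA
  simp only [Module.End.mul_apply, tensorDerivation_tmul, cayleyOmega_tmul, map_add, map_sub,
    pderiv_matDerivation, hA', TensorProduct.add_tmul, TensorProduct.tmul_add,
    TensorProduct.tmul_smul, ← TensorProduct.smul_tmul']
  module

lemma comm_cayleyOmega_pow (k : ℕ) (x : MvPolynomial (Fin 2) ℂ ⊗[ℂ] MvPolynomial (Fin 2) ℂ) :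
    (cayleyOmega ^ k) (TensorProduct.comm ℂ _ _ x) =
      (-1 : ℂ) ^ k • TensorProduct.comm ℂ _ _ ((cayleyOmega ^ k) x) := by
  have h1 : ∀ y, cayleyOmega (TensorProduct.comm ℂ _ _ y) =
      - TensorProduct.comm ℂ _ _ (cayleyOmega y) := by
    intro y
    induction y with
    | zero => simp
    | add y z hy hz => simp only [map_add, hy, hz, neg_add]
    | tmul p q => simp [cayleyOmega_tmul]
  induction k with
  | zero => simp
  | succ k ih =>
    rw [pow_succ' cayleyOmega, Module.End.mul_apply, Module.End.mul_apply, ih, map_smul, h1,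
      pow_succ' (-1 : ℂ)]
    module

lemma cayleyOmega_pow_mem {a b : ℕ} (k : ℕ) {p q : MvPolynomial (Fin 2) ℂ}
    (hp : p.IsHomogeneous a) (hq : q.IsHomogeneous b) :
    LinearMap.mul' ℂ _ ((cayleyOmega ^ k) (p ⊗ₜ[ℂ] q)) ∈
      homogeneousSubmodule (Fin 2) ℂ ((a - k) + (b - k)) := by
  induction k generalizing a b p q with
  | zero => simpa using hp.mul hq
  | succ k ih =>
    rw [pow_succ, Module.End.mul_apply, cayleyOmega_tmul, map_sub, map_sub]
    have h1 := ih (hp.pderiv (i := 0)) (hq.pderiv (i := 1))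
    have h2 := ih (hp.pderiv (i := 1)) (hq.pderiv (i := 0))
    rw [Nat.sub_sub, Nat.sub_sub, add_comm 1 k] at h1 h2
    exact Submodule.sub_mem _ h1 h2

lemma mul'_tensorDerivation (A : Matrix (Fin 2) (Fin 2) ℂ)
    (x : MvPolynomial (Fin 2) ℂ ⊗[ℂ] MvPolynomial (Fin 2) ℂ) :
    LinearMap.mul' ℂ _ (tensorDerivation A x) = matDerivation A (LinearMap.mul' ℂ _ x) := by
  induction x with
  | zero => simp
  | add y z hy hz => simp only [map_add, hy, hz]
  | tmul p q =>
    rw [tensorDerivation_tmul, map_add]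
    simp
    ring

lemma cayleyOmega_pow_tmul (a b k : ℕ) :
    (cayleyOmega ^ k) ((X 0 ^ a : MvPolynomial (Fin 2) ℂ) ⊗ₜ[ℂ] (X 1 ^ b)) =
      ((a.descFactorial k : ℂ) * b.descFactorial k) • ((X 0 ^ (a - k)) ⊗ₜ[ℂ] (X 1 ^ (b - k))) := by
  induction k with
  | zero => simp
  | succ k ih =>
    rw [pow_succ', Module.End.mul_apply, ih, map_smul, cayleyOmega_tmul]
    have h0 : pderiv 0 (X 0 ^ (a - k) : MvPolynomial (Fin 2) ℂ) =
        ((a - k : ℕ) : ℂ) • X 0 ^ (a - (k + 1)) := by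
      simp [Nat.sub_sub, MvPolynomial.smul_eq_C_mul]
    have h1 : pderiv 1 (X 1 ^ (b - k) : MvPolynomial (Fin 2) ℂ) =
        ((b - k : ℕ) : ℂ) • X 1 ^ (b - (k + 1)) := by
      simp [Nat.sub_sub, MvPolynomial.smul_eq_C_mul]
    have h2 : pderiv 1 (X 0 ^ (a - k) : MvPolynomial (Fin 2) ℂ) = 0 := by
      simp
    rw [h0, h1, h2, TensorProduct.zero_tmul, sub_zero, TensorProduct.smul_tmul_smul, smul_smul,
      Nat.descFactorial_succ, Nat.descFactorial_succ]
    congr 1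
    push_cast
    ring

/-- The transvectant of order `k` of two forms of degree `r`, that is, the image of `Ω^k (p ⊗ q)`
under multiplication. -/
def transvectant (r k n : ℕ) (hn : (r - k) + (r - k) = n) :
    BinForm r →ₗ[ℂ] BinForm r →ₗ[ℂ] BinForm n :=
  LinearMap.mk₂ ℂ (fun p q => ⟨LinearMap.mul' ℂ _ ((cayleyOmega ^ k) (p.1 ⊗ₜ[ℂ] q.1)),
      hn ▸ cayleyOmega_pow_mem k p.2 q.2⟩)
    (fun p p' q => by apply Subtype.ext; simp [TensorProduct.add_tmul])
    (fun c p q => by apply Subtype.ext; simp [← TensorProduct.smul_tmul'])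
    (fun p q q' => by apply Subtype.ext; simp [TensorProduct.tmul_add])
    (fun c p q => by apply Subtype.ext; simp)

lemma coe_transvectant {r k n : ℕ} (hn : (r - k) + (r - k) = n) (p q : BinForm r) :
    (transvectant r k n hn p q : MvPolynomial (Fin 2) ℂ) =
      LinearMap.mul' ℂ _ ((cayleyOmega ^ k) (p.1 ⊗ₜ[ℂ] q.1)) := rfl

lemma transvectant_comm {r k n : ℕ} (hn : (r - k) + (r - k) = n) (hk : Even k) (p q : BinForm r) :
    transvectant r k n hn p q = transvectant r k n hn q p := by
  apply Subtype.ext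
  rw [coe_transvectant, coe_transvectant, ← TensorProduct.comm_tmul, comm_cayleyOmega_pow,
    hk.neg_one_pow, one_smul]
  have h : ∀ x : MvPolynomial (Fin 2) ℂ ⊗[ℂ] MvPolynomial (Fin 2) ℂ,
      LinearMap.mul' ℂ _ (TensorProduct.comm ℂ _ _ x) = LinearMap.mul' ℂ _ x := by
    intro x
    induction x with
    | zero => simp
    | add y z hy hz => simp only [map_add, hy, hz]
    | tmul p q => simp [mul_comm]
  rw [h]

lemma slRep_transvectant {r k n : ℕ} (hn : (r - k) + (r - k) = n) (A : SL2) (p q : BinForm r) :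
    slRep n A (transvectant r k n hn p q) =
      transvectant r k n hn (slRep r A p) q + transvectant r k n hn p (slRep r A q) := by
  have hA : A.1 0 0 + A.1 1 1 = 0 := by
    have h : A.1 ∈ LinearMap.ker (Matrix.traceLinearMap (Fin 2) ℂ ℂ) := A.2
    simpa [Matrix.trace_fin_two] using h
  have hc : cayleyOmega ^ k * tensorDerivation A.1 = tensorDerivation A.1 * cayleyOmega ^ k :=
    (Commute.pow_left (cayleyOmega_mul_tensorDerivation A.1 hA) k)
  apply Subtype.ext
  rw [coe_slRep, Submodule.coe_add, coe_transvectant, coe_transvectant, coe_transvectant,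
    ← map_add, ← map_add, coe_slRep, coe_slRep, ← tensorDerivation_tmul, ← Module.End.mul_apply,
    hc, Module.End.mul_apply, mul'_tensorDerivation]

lemma transvectant_ne_zero {r k n : ℕ} (hn : (r - k) + (r - k) = n) (hk : k ≤ r) :
    ∃ p q : BinForm r, transvectant r k n hn p q ≠ 0 := by
  refine ⟨⟨X 0 ^ r, by simpa using (isHomogeneous_X ℂ (0 : Fin 2)).pow r⟩,
    ⟨X 1 ^ r, by simpa using (isHomogeneous_X ℂ (1 : Fin 2)).pow r⟩, fun h => ?_⟩
  have h1 := congrArg Subtype.val h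
  rw [coe_transvectant, cayleyOmega_pow_tmul, map_smul] at h1
  simp [Nat.descFactorial_eq_zero_iff_lt, hk.not_gt] at h1

/-- Transvection of order `2m` is a nonzero equivariant map on the symmetric square. -/
lemma exists_isEquivariant (r m : ℕ) (hm : 2 * m ≤ r) :
    ∃ f : Sym[ℂ]^2 (BinForm r) →ₗ[ℂ] BinForm (2 * r - 4 * m), IsEquivariant f ∧ f ≠ 0 := by
  have hn : (r - 2 * m) + (r - 2 * m) = 2 * r - 4 * m := by omega
  obtain ⟨f, hf⟩ := exists_linearMap_symMul (transvectant r (2 * m) _ hn)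
    (transvectant_comm hn (even_two_mul m))
  refine ⟨f, fun A u v => ?_, ?_⟩
  · rw [map_add, hf, hf, hf, slRep_transvectant]
  · rintro rfl
    obtain ⟨p, q, hpq⟩ := transvectant_ne_zero hn hm
    exact hpq (by rw [← hf]; rfl)

end Transvectants

/-! ### The Zariski topology on a projective space -/

section Zariski

variable {V : Type} [AddCommGroup V] [Module ℂ V]

lemma isClosed_zeroSet {d : ℕ} {F : MvPolynomial (Module.Dual ℂ V) ℂ} (hF : F.IsHomogeneous d) :
    IsClosed (zeroSet F) :=
  ⟨TopologicalSpace.isOpen_generateFrom_of_mem ⟨d, F, hF, rfl⟩⟩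

lemma mk_mem_zeroSet_iff {d : ℕ} {F : MvPolynomial (Module.Dual ℂ V) ℂ} (hF : F.IsHomogeneous d)
    {v : V} (hv : v ≠ 0) : Projectivization.mk ℂ v hv ∈ zeroSet F ↔
      MvPolynomial.eval (fun φ : Module.Dual ℂ V => φ v) F = 0 := by
  obtain ⟨a, ha⟩ := Projectivization.exists_smul_eq_mk_rep ℂ v hv
  have h : MvPolynomial.eval (fun φ : Module.Dual ℂ V => φ (a • v)) F =
      (a : ℂ) ^ d * MvPolynomial.eval (fun φ : Module.Dual ℂ V => φ v) F := by
    rw [MvPolynomial.eval_eq, MvPolynomial.eval_eq, Finset.mul_sum]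
    refine Finset.sum_congr rfl fun s hs => ?_
    have hs' : ∑ φ ∈ s.support, s φ = d := by
      have h1 := hF (MvPolynomial.mem_support_iff.1 hs)
      rw [Finsupp.weight_apply] at h1
      simpa [Finsupp.sum] using h1
    simp only [Units.smul_def, map_smul, smul_eq_mul, mul_pow, Finset.prod_mul_distrib,
      Finset.prod_pow_eq_pow_sum, hs']
    ring
  change MvPolynomial.eval (fun φ : Module.Dual ℂ V => φ (Projectivization.mk ℂ v hv).rep) F = 0 ↔ _
  rw [← ha, h, mul_eq_zero, or_iff_right (pow_ne_zero _ a.ne_zero)]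

/-- The complements of zero sets of single homogeneous polynomials form a basis. -/
lemma exists_zeroSet_of_isOpen {U : Set (ℙ ℂ V)} (hU : IsOpen U) {x : ℙ ℂ V} (hx : x ∈ U) :
    ∃ (d : ℕ) (F : MvPolynomial (Module.Dual ℂ V) ℂ), F.IsHomogeneous d ∧ x ∉ zeroSet F ∧
      (zeroSet F)ᶜ ⊆ U := by
  induction hU with
  | basic U hU =>
    obtain ⟨d, F, hF, rfl⟩ := hU
    exact ⟨d, F, hF, hx, subset_rfl⟩
  | univ =>
    exact ⟨0, 1, MvPolynomial.isHomogeneous_one _ _, by simp [zeroSet], Set.subset_univ _⟩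
  | inter U W _ _ ihU ihW =>
    obtain ⟨d, F, hF, hxF, hFU⟩ := ihU hx.1
    obtain ⟨e, G, hG, hxG, hGW⟩ := ihW hx.2
    refine ⟨d + e, F * G, hF.mul hG, ?_, fun y hy => ⟨hFU ?_, hGW ?_⟩⟩
    · simp only [zeroSet, Set.mem_ofPred_eq, map_mul, mul_eq_zero, not_or] at hxF hxG ⊢
      exact ⟨hxF, hxG⟩
    · simp only [zeroSet, Set.mem_compl_iff, Set.mem_ofPred_eq, map_mul, mul_eq_zero,
        not_or] at hy ⊢
      exact hy.1
    · simp only [zeroSet, Set.mem_compl_iff, Set.mem_ofPred_eq, map_mul, mul_eq_zero,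
        not_or] at hy ⊢
      exact hy.2
  | sUnion S _ ih =>
    obtain ⟨U, hU, hxU⟩ := hx
    obtain ⟨d, F, hF, hxF, hFU⟩ := ih U hU hxU
    exact ⟨d, F, hF, hxF, hFU.trans (Set.subset_sUnion_of_mem hU)⟩

/-- A set is irreducible if any two of its points are joined by a polynomial curve inside it: two
nonzero polynomials in one variable have a common non-root. -/
lemma isPreirreducible_of_polynomial_curves {S : Set (ℙ ℂ V)}
    (h : ∀ x ∈ S, ∀ y ∈ S, ∃ (γ : ℂ → V) (hγ : ∀ s, γ s ≠ 0),
      (∀ s, Projectivization.mk ℂ (γ s) (hγ s) ∈ S) ∧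
      Projectivization.mk ℂ (γ 0) (hγ 0) = x ∧ Projectivization.mk ℂ (γ 1) (hγ 1) = y ∧
      ∀ φ : Module.Dual ℂ V, ∃ q : Polynomial ℂ, ∀ s, φ (γ s) = q.eval s) :
    IsPreirreducible S := by
  rintro U W hU hW ⟨x, hxS, hxU⟩ ⟨y, hyS, hyW⟩
  obtain ⟨γ, hγ, hγS, hγx, hγy, hpoly⟩ := h x hxS y hyS
  choose q hq using hpoly
  obtain ⟨d, F, hF, hxF, hFU⟩ := exists_zeroSet_of_isOpen hU hxU
  obtain ⟨e, G, hG, hyG, hGW⟩ := exists_zeroSet_of_isOpen hW hyW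
  have heval : ∀ (F : MvPolynomial (Module.Dual ℂ V) ℂ) (s : ℂ),
      MvPolynomial.eval (fun φ : Module.Dual ℂ V => φ (γ s)) F =
        (MvPolynomial.aeval q F).eval s := by
    intro F s
    simp only [hq]
    induction F using MvPolynomial.induction_on with
    | C a => simp
    | add p q hp hq => simp [hp, hq]
    | mul_X p φ hp => simp [hp]
  rw [← hγx, mk_mem_zeroSet_iff hF, heval] at hxF
  rw [← hγy, mk_mem_zeroSet_iff hG, heval] at hyG
  have hne : MvPolynomial.aeval q F * MvPolynomial.aeval q G ≠ 0 := by
    refine mul_ne_zero ?_ ?_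
    · rintro h0
      exact hxF (by rw [h0, Polynomial.eval_zero])
    · rintro h0
      exact hyG (by rw [h0, Polynomial.eval_zero])
  obtain ⟨s, hs⟩ : ∃ s, (MvPolynomial.aeval q F * MvPolynomial.aeval q G).eval s ≠ 0 := by
    by_contra! hall
    exact hne (Polynomial.funext fun s => by rw [hall s, Polynomial.eval_zero])
  rw [Polynomial.eval_mul, mul_ne_zero_iff, ← heval, ← heval, Ne, Ne,
    ← mk_mem_zeroSet_iff hF (hγ s), ← mk_mem_zeroSet_iff hG (hγ s)] at hs
  exact ⟨_, hγS s, hFU hs.1, hGW hs.2⟩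

lemma isClosed_setOf_bilin_rep_eq_zero [Module.Finite ℂ V] (B : V →ₗ[ℂ] V →ₗ[ℂ] ℂ) :
    IsClosed {x : ℙ ℂ V | B x.rep x.rep = 0} := by
  let b := Module.finBasis ℂ V
  let F : MvPolynomial (Module.Dual ℂ V) ℂ := ∑ i, ∑ j,
    MvPolynomial.C (B (b i) (b j)) * (MvPolynomial.X (b.coord i) * MvPolynomial.X (b.coord j))
  have hF : F.IsHomogeneous 2 := by
    refine MvPolynomial.IsHomogeneous.sum _ _ _ fun i _ =>
      MvPolynomial.IsHomogeneous.sum _ _ _ fun j _ => ?_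
    exact ((MvPolynomial.isHomogeneous_X ℂ _).mul (MvPolynomial.isHomogeneous_X ℂ _)).C_mul _
  have h : {x : ℙ ℂ V | B x.rep x.rep = 0} = zeroSet F := by
    ext x
    have hx : B x.rep x.rep = MvPolynomial.eval (fun φ : Module.Dual ℂ V => φ x.rep) F := by
      conv_lhs => rw [← b.sum_repr x.rep]
      simp only [F, map_sum, map_smul, LinearMap.sum_apply, LinearMap.smul_apply, smul_eq_mul,
        map_mul, MvPolynomial.eval_C, MvPolynomial.eval_X, Module.Basis.coord_apply]
      rw [Finset.sum_comm]
      simp only [Finset.mul_sum]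
      refine Finset.sum_congr rfl fun i _ => Finset.sum_congr rfl fun j _ => ?_
      ring
    rw [Set.mem_ofPred_eq, hx]
    rfl
  rw [h]
  exact isClosed_zeroSet hF

end Zariski

/-- A chain of irreducible closed subsets of the ambient space inside a set bounds the Krull
dimension of this set from below. -/
lemma le_topologicalKrullDim_of_chain {X : Type*} [TopologicalSpace X] {Z : Set X} {m : ℕ}
    (c : ℕ → Set X) (hirr : ∀ i, IsIrreducible (c i)) (hcl : ∀ i, IsClosed (c i))
    (hlt : ∀ i < m, c i ⊂ c (i + 1)) (hZ : ∀ i ≤ m, c i ⊆ Z) :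
    (m : WithBot ℕ∞) ≤ topologicalKrullDim Z := by
  have hpre : ∀ i ≤ m, IsIrreducible (Subtype.val ⁻¹' c i : Set Z) := by
    intro i hi
    refine ⟨?_, ?_⟩
    · obtain ⟨x, hx⟩ := (hirr i).nonempty
      exact ⟨⟨x, hZ i hi hx⟩, hx⟩
    · rintro _ _ ⟨U, hU, rfl⟩ ⟨W, hW, rfl⟩ ⟨x, hxc, hxU⟩ ⟨y, hyc, hyW⟩
      obtain ⟨z, hzc, hz⟩ := (hirr i).isPreirreducible U W hU hW ⟨x, hxc, hxU⟩ ⟨y, hyc, hyW⟩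
      exact ⟨⟨z, hZ i hi hzc⟩, hzc, hz⟩
  let T : Fin (m + 1) → TopologicalSpace.IrreducibleCloseds Z := fun i =>
    ⟨Subtype.val ⁻¹' c i, hpre i (Nat.lt_succ_iff.1 i.2), (hcl i).preimage continuous_subtype_val⟩
  have hT : StrictMono T := by
    refine Fin.strictMono_iff_lt_succ.2 fun i => ?_
    have h := hlt i i.2
    refine lt_of_le_of_ne (fun x hx => h.1 hx) fun heq => h.2 fun x hx => ?_
    have h1 : (⟨x, hZ (i + 1) i.2 hx⟩ : Z) ∈ T i.succ := hx
    rw [← heq] at h1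
    exact h1
  exact Order.LTSeries.length_le_krullDim (LTSeries.mk m T hT)

/-! ### Osculating varieties and the quadratic locus -/

instance (r : ℕ) : Module.Finite ℂ (BinForm r) := by
  classical
  refine ⟨⟨(Finset.range (r + 1)).image (lowVec r), ?_⟩⟩
  rw [eq_top_iff, ← span_lowVec, Submodule.span_le]
  rintro _ ⟨k, rfl⟩
  rcases lt_or_ge r k with h | h
  · rw [lowVec_eq_zero h]
    exact Submodule.zero_mem _
  · refine Submodule.subset_span ?_
    rw [Finset.mem_coe, Finset.mem_image]
    exact ⟨k, Finset.mem_range.2 (by omega), rfl⟩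

lemma isClosed_quadricLocus {r n : ℕ} (f : Sym[ℂ]^2 (BinForm r) →ₗ[ℂ] BinForm n) :
    IsClosed (quadricLocus f) := by
  have h : quadricLocus f = ⋂ s : Fin 2 →₀ ℕ, {x | (bilin f).compr₂
      (MvPolynomial.lcoeff (R := ℂ) s ∘ₗ Submodule.subtype _) x.rep x.rep = 0} := by
    ext x
    rw [Set.mem_iInter]
    change bilin f x.rep x.rep = 0 ↔ ∀ s, MvPolynomial.coeff s (bilin f x.rep x.rep).1 = 0
    rw [← Submodule.coe_eq_zero, MvPolynomial.ext_iff]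
    simp
  rw [h]
  exact isClosed_iInter fun s => isClosed_setOf_bilin_rep_eq_zero _

lemma mk_mem_quadricLocus_iff {r n : ℕ} (f : Sym[ℂ]^2 (BinForm r) →ₗ[ℂ] BinForm n)
    {v : BinForm r} (hv : v ≠ 0) :
    Projectivization.mk ℂ v hv ∈ quadricLocus f ↔ bilin f v v = 0 := by
  obtain ⟨a, ha⟩ := Projectivization.exists_smul_eq_mk_rep ℂ v hv
  change bilin f (Projectivization.mk ℂ v hv).rep (Projectivization.mk ℂ v hv).rep = 0 ↔ _
  rw [← ha, Units.smul_def]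
  simp

lemma eval_lowVec (r i : ℕ) (x : Fin 2 → ℂ) :
    MvPolynomial.eval x (lowVec r i : MvPolynomial (Fin 2) ℂ) =
      r.descFactorial i * (x 0 ^ (r - i) * x 1 ^ i) := by
  simp [coe_lowVec]

lemma eval_curveDeriv (r k : ℕ) (t : ℂ) (x : Fin 2 → ℂ) :
    MvPolynomial.eval x (curveDeriv r k t : MvPolynomial (Fin 2) ℂ) =
      ∑ i ∈ Finset.range (r + 1), ((i.descFactorial k : ℂ) * t ^ (i - k) * (i.factorial : ℂ)⁻¹) *
        (r.descFactorial i * (x 0 ^ (r - i) * x 1 ^ i)) := by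
  rw [curveDeriv_eq_sum_range]
  simp only [Submodule.coe_sum, Submodule.coe_smul, map_sum, MvPolynomial.smul_eval, eval_lowVec]

lemma osculatingVec_ne_zero (r p : ℕ) (t : ℂ) (l : Fin p → ℂ) : osculatingVec r p t l ≠ 0 := by
  -- The coordinate at `x₀` is the value of the form at `(1, 0)`.
  have h : ∀ k, MvPolynomial.eval ![1, 0] (curveDeriv r k t : MvPolynomial (Fin 2) ℂ) =
      Nat.descFactorial 0 k := by
    intro k
    rw [eval_curveDeriv, Finset.sum_eq_single 0]
    · simp
    · intro i _ hi
      simp [hi]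
    · simp
  intro h0
  have h1 := congrArg (fun u : BinForm r => MvPolynomial.eval ![1, 0] u.1) h0
  simp [osculatingVec, h, MvPolynomial.smul_eval] at h1

/-- The part of the osculating variety which is given by the parametrisation. -/
def osculatingPoints (r p : ℕ) : Set (ℙ ℂ (BinForm r)) :=
  {x | ∃ (t : ℂ) (l : Fin p → ℂ) (h : osculatingVec r p t l ≠ 0),
    x = Projectivization.mk ℂ (osculatingVec r p t l) h}

lemma mk_mem_osculatingPoints (r p : ℕ) (t : ℂ) (l : Fin p → ℂ) :
    Projectivization.mk ℂ (osculatingVec r p t l) (osculatingVec_ne_zero r p t l) ∈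
      osculatingPoints r p := ⟨t, l, _, rfl⟩

lemma mk_mem_osculatingVariety (r p : ℕ) (t : ℂ) (l : Fin p → ℂ) :
    Projectivization.mk ℂ (osculatingVec r p t l) (osculatingVec_ne_zero r p t l) ∈
      osculatingVariety r p := subset_closure (mk_mem_osculatingPoints r p t l)

lemma exists_polynomial_curveDeriv (r k : ℕ) (t t' : ℂ) (φ : Module.Dual ℂ (BinForm r)) :
    ∃ q : Polynomial ℂ, ∀ s, φ (curveDeriv r k (t + s * t')) = q.eval s := by
  refine ⟨∑ i ∈ Finset.range (r + 1), Polynomial.C (i.descFactorial k : ℂ) *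
    (Polynomial.C t + Polynomial.X * Polynomial.C t') ^ (i - k) *
    Polynomial.C ((i.factorial : ℂ)⁻¹) * Polynomial.C (φ (lowVec r i)), fun s => ?_⟩
  rw [curveDeriv_eq_sum_range]
  simp [Polynomial.eval_finsetSum, mul_comm s]

/-- The osculating varieties are irreducible, being the closures of images of affine spaces. -/
lemma isIrreducible_osculatingVariety (r p : ℕ) : IsIrreducible (osculatingVariety r p) := by
  refine IsIrreducible.closure (s := osculatingPoints r p)
    ⟨⟨_, mk_mem_osculatingPoints r p 0 0⟩, isPreirreducible_of_polynomial_curves ?_⟩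
  rintro _ ⟨t, l, h, rfl⟩ _ ⟨t', l', h', rfl⟩
  refine ⟨fun s => osculatingVec r p (t + s * (t' - t)) (l + s • (l' - l)),
    fun s => osculatingVec_ne_zero _ _ _ _, fun s => mk_mem_osculatingPoints _ _ _ _, ?_, ?_, ?_⟩
  · simp
  · simp
  · intro φ
    choose q hq using fun k => exists_polynomial_curveDeriv r k t (t' - t) φ
    refine ⟨q 0 + ∑ j : Fin p, (Polynomial.C (l j) + Polynomial.X * Polynomial.C (l' j - l j)) *
      q (j + 1), fun s => ?_⟩
    simp [osculatingVec, hq, Polynomial.eval_finsetSum]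

lemma osculatingVariety_subset_succ (r p : ℕ) :
    osculatingVariety r p ⊆ osculatingVariety r (p + 1) := by
  refine closure_mono ?_
  rintro _ ⟨t, l, h, rfl⟩
  have h1 : osculatingVec r (p + 1) t (Fin.snoc l 0) = osculatingVec r p t l := by
    simp [osculatingVec, Fin.sum_univ_castSucc]
  exact ⟨t, Fin.snoc l 0, h1 ▸ h, by simp only [h1]⟩

section Locus

variable {r n m : ℕ} {f : Sym[ℂ]^2 (BinForm r) →ₗ[ℂ] BinForm n}

lemma IsEquivariant.osculatingVariety_subset (hf : IsEquivariant f) (hn : n + 4 * m = 2 * r)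
    (hm : 1 ≤ m) : osculatingVariety r (m - 1) ⊆ quadricLocus f := by
  refine closure_minimal ?_ (isClosed_quadricLocus f)
  rintro _ ⟨t, l, h, rfl⟩
  rw [mk_mem_quadricLocus_iff]
  have h1 : ∀ i < m, ∀ j < m, bilin f (curveDeriv r i t) (curveDeriv r j t) = 0 :=
    fun i hi j hj => hf.bilin_curveDeriv_eq_zero hn (by omega) t
  have h2 : ∀ i < m, bilin f (curveDeriv r i t) (osculatingVec r (m - 1) t l) = 0 := by
    intro i hi
    simp only [osculatingVec, map_add, map_sum, map_smul]
    rw [h1 i hi 0 (by omega), zero_add]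
    exact Finset.sum_eq_zero fun j _ => by rw [h1 i hi _ (by omega), smul_zero]
  conv_lhs => enter [1]; rw [osculatingVec]
  simp only [map_add, map_sum, map_smul, LinearMap.add_apply, LinearMap.sum_apply,
    LinearMap.smul_apply]
  rw [h2 0 (by omega), zero_add]
  exact Finset.sum_eq_zero fun j _ => by rw [h2 _ (by omega), smul_zero]

lemma IsEquivariant.not_osculatingVariety_subset (hf : IsEquivariant f)
    (hn : n + 4 * m = 2 * r) (hf0 : f ≠ 0) : ¬ osculatingVariety r m ⊆ quadricLocus f := by
  intro hsub
  have hmid := hf.bilin_lowVec_middle_ne_zero hn hf0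
  rcases m with _ | m
  · have h := hsub (mk_mem_osculatingVariety r 0 0 0)
    rw [mk_mem_quadricLocus_iff] at h
    simp only [osculatingVec, Finset.univ_eq_empty, Finset.sum_empty, add_zero,
      curveDeriv_zero_right (Nat.zero_le r)] at h
    exact hmid h
  · -- The square of `x₀ + Y^m x₀` has the same image as that of `Y^m x₀`.
    have h := hsub (mk_mem_osculatingVariety r (m + 1) 0 (Pi.single (Fin.last m) 1))
    have hv : osculatingVec r (m + 1) 0 (Pi.single (Fin.last m) 1) =
        lowVec r 0 + lowVec r (m + 1) := by
      rw [osculatingVec, Finset.sum_eq_single (Fin.last m)]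
      · rw [curveDeriv_zero_right (Nat.zero_le r), curveDeriv_zero_right (by simp; omega)]
        simp
      · intro j _ hj
        simp [hj]
      · simp
    rw [mk_mem_quadricLocus_iff, hv, map_add, map_add, LinearMap.add_apply, LinearMap.add_apply,
      hf.bilin_lowVec_eq_zero hn (by omega), hf.bilin_lowVec_eq_zero hn (by omega),
      hf.bilin_lowVec_eq_zero hn (by omega), zero_add, zero_add, zero_add] at h
    exact hmid h

end Locus

/-- Consecutive osculating varieties are separated by a quadratic locus. -/
lemma osculatingVariety_ssubset_succ {r p : ℕ} (hp : 2 * (p + 1) ≤ r) :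
    osculatingVariety r p ⊂ osculatingVariety r (p + 1) := by
  obtain ⟨f, hf, hf0⟩ := exists_isEquivariant r (p + 1) hp
  have hn : 2 * r - 4 * (p + 1) + 4 * (p + 1) = 2 * r := by omega
  refine ⟨osculatingVariety_subset_succ r p, fun h => ?_⟩
  exact hf.not_osculatingVariety_subset hn hf0
    (h.trans (hf.osculatingVariety_subset hn (by omega)))

/-- The point `x₀` of the rational normal curve. -/
def maxPoint (r : ℕ) : ℙ ℂ (BinForm r) :=
  Projectivization.mk ℂ (osculatingVec r 0 0 0) (osculatingVec_ne_zero r 0 0 0)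

lemma closure_maxPoint_ssubset {r : ℕ} (hr : 1 ≤ r) :
    closure {maxPoint r} ⊂ osculatingVariety r 0 := by
  refine ⟨closure_minimal (Set.singleton_subset_iff.2 (mk_mem_osculatingVariety r 0 0 0))
    isClosed_closure, fun hsub => ?_⟩
  -- The coordinate at `x_r`, the value of a form at `(0, 1)`, vanishes at `x₀` but not at the
  -- point of the curve with parameter `1`.
  let φ : Module.Dual ℂ (BinForm r) :=
    (MvPolynomial.aeval (R := ℂ) ![(0 : ℂ), 1]).toLinearMap ∘ₗ Submodule.subtype _
  have hφ : ∀ u : BinForm r, φ u = MvPolynomial.eval ![0, 1] (u : MvPolynomial (Fin 2) ℂ) :=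
    fun u => by simp [φ, MvPolynomial.aeval_eq_eval]
  have hF : (MvPolynomial.X φ : MvPolynomial (Module.Dual ℂ (BinForm r)) ℂ).IsHomogeneous 1 :=
    MvPolynomial.isHomogeneous_X ℂ φ
  have h0 : maxPoint r ∈ zeroSet (MvPolynomial.X φ) := by
    rw [maxPoint, mk_mem_zeroSet_iff hF, MvPolynomial.eval_X, hφ]
    simp [osculatingVec, curveDeriv_zero_right, eval_lowVec]
    omega
  have h1 : Projectivization.mk ℂ _ (osculatingVec_ne_zero r 0 1 0) ∈
      zeroSet (MvPolynomial.X φ) :=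
    closure_minimal (Set.singleton_subset_iff.2 h0) (isClosed_zeroSet hF)
      (hsub (mk_mem_osculatingVariety r 0 1 0))
  rw [mk_mem_zeroSet_iff hF, MvPolynomial.eval_X, hφ, osculatingVec, Finset.univ_eq_empty,
    Finset.sum_empty, add_zero, eval_curveDeriv, Finset.sum_eq_single r] at h1
  · simp [Nat.descFactorial_self, Nat.factorial_ne_zero] at h1
  · intro i hi hir
    have hlt : i < r := lt_of_le_of_ne (Nat.lt_succ_iff.1 (Finset.mem_range.1 hi)) hir
    simp [Nat.sub_ne_zero_of_lt hlt]
  · simp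

/-- The chain of irreducible closed sets `closure {x₀} ⊂ T⁰c_r ⊂ T¹c_r ⊂ …`. -/
def osculatingFlag (r : ℕ) : ℕ → Set (ℙ ℂ (BinForm r))
  | 0 => closure {maxPoint r}
  | p + 1 => osculatingVariety r p

lemma IsEquivariant.le_topologicalKrullDim {r n m : ℕ}
    {f : Sym[ℂ]^2 (BinForm r) →ₗ[ℂ] BinForm n} (hf : IsEquivariant f)
    (hn : n + 4 * m = 2 * r) (hm : 1 ≤ m) :
    (m : WithBot ℕ∞) ≤ topologicalKrullDim (quadricLocus f) := by
  have hmono : Monotone (osculatingFlag r) := by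
    refine monotone_nat_of_le_succ fun i => ?_
    rcases i with _ | i
    · exact (closure_maxPoint_ssubset (by omega)).1
    · exact osculatingVariety_subset_succ r i
  refine le_topologicalKrullDim_of_chain (osculatingFlag r) ?_ ?_ ?_ ?_
  · rintro (_ | i)
    · exact isIrreducible_singleton.closure
    · exact isIrreducible_osculatingVariety r i
  · rintro (_ | i) <;> exact isClosed_closure
  · rintro (_ | i) hi
    · exact closure_maxPoint_ssubset (by omega)
    · exact osculatingVariety_ssubset_succ (by omega)
  · intro i hi
    obtain ⟨k, rfl⟩ := Nat.exists_eq_add_of_le' hm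
    exact (hmono hi).trans (hf.osculatingVariety_subset hn hm)

end OsculatingVeronese

end

open OsculatingVeronese
theorem mainTheorem5 (r m : ℕ) (hr : 2 ≤ r) (hm : 2 * m ≤ r) :
    (∃ f : Sym[ℂ]^2 (BinForm r) →ₗ[ℂ] BinForm (2 * r - 4 * m), IsEquivariant f ∧ f ≠ 0) ∧
    ∀ f : Sym[ℂ]^2 (BinForm r) →ₗ[ℂ] BinForm (2 * r - 4 * m), IsEquivariant f → f ≠ 0 →
      (1 ≤ m → osculatingVariety r (m - 1) ⊆ quadricLocus f) ∧
      ¬ osculatingVariety r m ⊆ quadricLocus f ∧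
      (1 ≤ m → (m : WithBot ℕ∞) ≤ topologicalKrullDim (quadricLocus f)) := by
  have hn : 2 * r - 4 * m + 4 * m = 2 * r := by omega
  exact ⟨exists_isEquivariant r m hm, fun f hf hf0 => ⟨hf.osculatingVariety_subset hn,
    hf.not_osculatingVariety_subset hn hf0, hf.le_topologicalKrullDim hn⟩⟩
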